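/- **Theorem 3.7 (Non-associative Baker–Campbell–Hausdorff formula).** Let $k$ be a field of characteristic zero and let $k\{\{x,y\}\}$ be the unital algebra of formal power series over $k$ in two non-associative variables $x,y$. For a series $u$ without constant term put $\exp_l(u)=\sum_{n\ge 0}\frac1{n!}u^n$ with left-normed powers $u^n=(((uu)\cdots)u)u$, and let $\log_l$ be the inverse of the bijection $u\mapsto\exp_l(u)$ from the series without constant term onto the series with constant term $1$. Let $k\{X\}$ be the free unital non-associative algebra on a set $X$, let $\Delta$ and $\epsilon$ be the homomorphisms of unital algebras with $\Delta(v)=v\otimes 1+1\otimes v$ and $\epsilon(v)=0$ for $v\in X$ (write $\Delta(u)=\sum u_{(1)}\otimes u_{(2)}$), and let $\backslash$ be the left division, determined by $\sum u_{(1)}\backslash(u_{(2)}w)=\epsilon(u)w=\sum u_{(1)}(u_{(2)}\backslash w)$. In the free unital algebra on $x_1,\dots,x_m,y_1,\dots,y_n,z$ put $\underline x=((x_1x_2)\cdots)x_m$, $\underline y=((y_1y_2)\cdots)y_n$, $(a,b,c)=(ab)c-a(bc)$ and $$p(x_1,\dots,x_m;y_1,\dots,y_n;z)=\sum(\underline x_{(1)}\underline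 y_{(1)})\backslash(\underline x_{(2)},\underline y_{(2)},z),$$ and regard $p$, by evaluation, as a multilinear operation on any unital $k$-algebra. For $m,n\ge1$ define $[a,b]=ab-ba$, $$\langle x_1,\dots,x_m;y,z\rangle=-p(x_1,\dots,x_m;y;z)+p(x_1,\dots,x_m;z;y),$$ $$\Phi(x_1,\dots,x_m;y_1,\dots,y_{n+1})=\frac1{m!(n+1)!}\sum_{\sigma\in S_m,\ \tau\in S_{n+1}}p(x_{\sigma(1)},\dots,x_{\sigma(m)};y_{\tau(1)},\dots,y_{\tau(n)};y_{\tau(n+1)}).$$ Then in $k\{\{x,y\}\}$ the series $\log_l(\exp_l(x)\exp_l(y))$ is equal to $$\begin{aligned} & x+y+\tfrac12[x,y]\\ &+\tfrac1{12}[x,[x,y]]-\tfrac13\langle x;x,y\rangle-\tfrac1{12}[y,[x,y]]-\tfrac16\langle y;x,y\rangle-\tfrac12\Phi(x;y,y)\\ &-\tfrac1{24}\langle x;x,[x,y]\rangle-\tfrac1{12}[x,\langle x;x,y\rangle]-\tfrac18\langle x,x;x,y\rangle\\ &+\tfrac1{24}[[x,[x,y]],y]-\tfrac1{24}[x,\langle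 y;x,y\rangle]-\tfrac14\Phi(x,x;y,y)-\tfrac14[x,\Phi(x;y,y)]\\ &-\tfrac1{24}[\langle x;x,y\rangle,y]-\tfrac1{24}\langle x;[x,y],y\rangle-\tfrac16\langle x,y;x,y\rangle+\tfrac1{24}\langle y,x;x,y\rangle\\ &+\tfrac1{12}[\Phi(x;y,y),y]+\tfrac1{24}\langle y;y,[x,y]\rangle-\tfrac1{24}\langle y,y;x,y\rangle-\tfrac16\Phi(x;y,y,y) \end{aligned}$$ plus terms of degree $\ge 5$. -/

import Mathlib

open scoped TensorProduct

noncomputable section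

namespace NonassocBCH

/-! ### Non-associative monomials -/

/-- Non-associative monomials in the variables `X`, including the empty monomial `1`. -/
abbrev Word (X : Type*) := WithOne (FreeMagma X)

/-- The monomial consisting of a single variable. -/
def var {X : Type*} (i : X) : Word X := ((FreeMagma.of i : FreeMagma X) : WithOne (FreeMagma X))

/-- The degree (number of letters) of a monomial. -/
def degree {X : Type*} (w : Word X) : ℕ :=
  WithOne.recOneCoe (motive := fun _ => ℕ) 0 FreeMagma.length w

/-- The left-normed product `((x₁ x₂) ⋯) xₘ` (equal to `1` if `m = 0`). -/
def leftNormed {M : Type*} [Mul M] [One M] {m : ℕ} (x : Fin m → M) : M :=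
  (List.ofFn x).foldl (fun a b => a * b) 1

@[simp] theorem degree_one {X : Type*} : degree (1 : Word X) = 0 := rfl

@[simp] theorem degree_coe {X : Type*} (u : FreeMagma X) :
    degree (u : Word X) = u.length := rfl

theorem degree_mul {X : Type*} (u v : Word X) : degree (u * v) = degree u + degree v := by
  cases u using WithOne.recOneCoe with
  | one => simp
  | coe u =>
    cases v using WithOne.recOneCoe with
    | one => simp
    | coe v => rfl

theorem degree_eq_zero {X : Type*} {u : Word X} (h : degree u = 0) : u = 1 := by
  cases u using WithOne.recOneCoe with
  | one => rfl
  | coe u =>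
    have := FreeMagma.length_pos u
    simp at h
    omega

theorem degree_pos {X : Type*} {u : Word X} (h : u ≠ 1) : 0 < degree u :=
  Nat.pos_of_ne_zero fun h' => h (degree_eq_zero h')

/-! ### The free unital non-associative algebra as a Hopf algebra -/

/-- The free unital non-associative algebra `k{X}`. -/
abbrev FreeAlg (k X : Type*) [Field k] := MonoidAlgebra k (Word X)

/-- A monomial, as an element of `k{X}`. -/
def mon (k : Type*) [Field k] {X : Type*} (w : Word X) : FreeAlg k X :=
  MonoidAlgebra.single w 1

section Eval

variable {k X A : Type*} [Field k] [NonAssocSemiring A] [Module k A]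

/-- The value of a monomial at elements `s i` of a unital non-associative algebra. -/
def evalWord (s : X → A) : Word X →* A := WithOne.lift (FreeMagma.lift s)

theorem evalWord_var (s : X → A) (i : X) : evalWord s (var i) = s i := rfl

/-- Evaluation of a non-associative polynomial, i.e. the homomorphism of unital algebras
`k{X} → A` sending each variable `i` to `s i`. -/
def eval (s : X → A) : FreeAlg k X →ₗ[k] A :=
  Finsupp.linearCombination k (fun w => evalWord s w) ∘ₗ
    (MonoidAlgebra.coeffLinearEquiv k).toLinearMap

@[simp] theorem eval_mon (s : X → A) (w : Word X) :
    eval (k := k) s (mon k w) = evalWord s w := by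
  simp [eval, mon]

end Eval

theorem FreeAlg.induction {k X : Type*} [Field k] {P : FreeAlg k X → Prop} (u : FreeAlg k X)
    (zero : P 0) (add : ∀ a b, P a → P b → P (a + b))
    (smul_mon : ∀ (c : k) (w : Word X), P (c • mon k w)) : P u := by
  refine MonoidAlgebra.induction_linear u zero add fun w c => ?_
  have := smul_mon c w
  simpa [mon] using this

theorem eval_one {k X A : Type*} [Field k] [NonAssocSemiring A] [Module k A] (s : X → A) :
    eval (k := k) s 1 = 1 := by
  have : (1 : FreeAlg k X) = mon k 1 := rfl
  rw [this, eval_mon, map_one]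

theorem eval_mul {k X A : Type*} [Field k] [NonAssocSemiring A] [Module k A]
    [IsScalarTower k A A] [SMulCommClass k A A] (s : X → A) (u v : FreeAlg k X) :
    eval s (u * v) = eval s u * eval s v := by
  induction u using FreeAlg.induction with
  | zero => simp
  | add a b ha hb => simp [add_mul, ha, hb]
  | smul_mon c w =>
    induction v using FreeAlg.induction with
    | zero => simp
    | add a b ha hb => simp only [mul_add, map_add, ha, hb]
    | smul_mon d z =>
      have : mon k w * mon k z = mon k (w * z) := by
        simp [mon, MonoidAlgebra.single_mul_single]
      rw [smul_mul_assoc, mul_smul_comm, this]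
      simp [smul_mul_assoc, mul_smul_comm, smul_comm c d]

/-- The comultiplication: the homomorphism of unital algebras with `i ↦ i ⊗ 1 + 1 ⊗ i`. -/
def comul (k X : Type*) [Field k] : FreeAlg k X →ₗ[k] FreeAlg k X ⊗[k] FreeAlg k X :=
  eval fun i => mon k (var i) ⊗ₜ[k] 1 + 1 ⊗ₜ[k] mon k (var i)

/-- The counit: the homomorphism of unital algebras with `i ↦ 0`. -/
def counit (k X : Type*) [Field k] : FreeAlg k X →ₗ[k] k := eval fun _ => 0

/-- The terms of `Δ(w) = ∑ w₍₁₎ ⊗ w₍₂₎` for a non-empty monomial `w`. -/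
def sweedlerAux {X : Type*} : FreeMagma X → List (Word X × Word X)
  | FreeMagma.of i => [(var i, 1), (1, var i)]
  | FreeMagma.mul u v =>
      (sweedlerAux u ×ˢ sweedlerAux v).map fun t => (t.1.1 * t.2.1, t.1.2 * t.2.2)

/-- The terms of `Δ(w) = ∑ w₍₁₎ ⊗ w₍₂₎` for a monomial `w`. -/
def sweedler {X : Type*} (w : Word X) : List (Word X × Word X) :=
  WithOne.recOneCoe (motive := fun _ => List (Word X × Word X)) [(1, 1)] sweedlerAux w

@[simp] theorem sweedler_one {X : Type*} : sweedler (1 : Word X) = [(1, 1)] := rfl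

theorem sweedler_var {X : Type*} (i : X) : sweedler (var i) = [(var i, 1), (1, var i)] := rfl

theorem sweedler_coe_mul {X : Type*} (u v : FreeMagma X) :
    sweedler ((FreeMagma.mul u v : FreeMagma X) : Word X) =
      (sweedler (u : Word X) ×ˢ sweedler (v : Word X)).map
        fun t => (t.1.1 * t.2.1, t.1.2 * t.2.2) := rfl

theorem sum_product_mul {α β R : Type*} [NonUnitalNonAssocSemiring R] (l : List α) (l' : List β)
    (f : α → R) (g : β → R) :
    ((l ×ˢ l').map fun t => f t.1 * g t.2).sum = (l.map f).sum * (l'.map g).sum := by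
  induction l with
  | nil => simp
  | cons a l ih =>
    rw [List.product_cons, List.map_append, List.sum_append, ih, List.map_map]
    simp [add_mul, Function.comp_def, List.sum_map_mul_left]

theorem comul_mon {k X : Type*} [Field k] (w : Word X) :
    comul k X (mon k w) =
      ((sweedler w).map fun t => mon k t.1 ⊗ₜ[k] mon k t.2).sum := by
  rw [comul, eval_mon]
  cases w using WithOne.recOneCoe with
  | one => simp [mon]; rfl
  | coe w =>
    induction w using FreeMagma.rec with
    | of i =>
      change evalWord _ (var i) = (List.map _ (sweedler (var i))).sum
      rw [evalWord_var, sweedler_var]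
      simp [mon]
      rfl
    | mul u v hu hv =>
      have h : (((u * v : FreeMagma X)) : Word X) = (u : Word X) * (v : Word X) := rfl
      change evalWord _ ((u * v : FreeMagma X) : Word X) = _
      rw [h, map_mul, hu, hv, ← sum_product_mul]
      change _ = (List.map _ (sweedler ((FreeMagma.mul u v : FreeMagma X) : Word X))).sum
      rw [sweedler_coe_mul, List.map_map]
      congr 1
      apply List.map_congr_left
      intro t _
      simp [mon, MonoidAlgebra.single_mul_single]

theorem degree_of_mem_sweedler {X : Type*} {w : Word X} {t : Word X × Word X}
    (ht : t ∈ sweedler w) : degree t.1 + degree t.2 = degree w := by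
  cases w using WithOne.recOneCoe with
  | one => simp at ht; simp [ht]
  | coe w =>
    induction w using FreeMagma.rec generalizing t with
    | of i =>
      have : t ∈ sweedler (var i) := ht
      rw [sweedler_var] at this
      simp at this
      rcases this with rfl | rfl <;> simp [var]
    | mul u v hu hv =>
      change t ∈ sweedler ((FreeMagma.mul u v : FreeMagma X) : Word X) at ht
      rw [sweedler_coe_mul] at ht
      simp only [List.mem_map, List.mem_product, Prod.exists] at ht
      obtain ⟨a, b, c, d, ⟨h1, h2⟩, rfl⟩ := ht
      have h1 := hu h1
      have h2 := hv h2
      simp [degree_mul] at h1 h2 ⊢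
      omega

open Classical in
/-- Left division by a monomial `w`, determined recursively by the identity
`∑ w₍₁₎ (w₍₂₎ \ y) = ε(w) y`, in which the only term with `w₍₁₎ = 1` is `w \ y`. -/
def leftDivWord (k : Type*) [Field k] {X : Type*} (w : Word X) :
    FreeAlg k X →ₗ[k] FreeAlg k X :=
  counit k X (mon k w) • LinearMap.id -
    (((sweedler w).filter (fun t => t.1 ≠ 1)).attach.map fun t =>
      LinearMap.mul k (FreeAlg k X) (mon k t.1.1) ∘ₗ leftDivWord k t.1.2).sum
termination_by degree w
decreasing_by
  have h := List.mem_filter.1 t.2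
  have h1 := degree_of_mem_sweedler h.1
  have h2 := degree_pos (of_decide_eq_true h.2)
  omega

open Classical in
theorem leftDivWord_eq (k : Type*) [Field k] {X : Type*} (w : Word X) (y : FreeAlg k X) :
    leftDivWord k w y = counit k X (mon k w) • y -
      (((sweedler w).filter (fun t => t.1 ≠ 1)).map fun t =>
        mon k t.1 * leftDivWord k t.2 y).sum := by
  have h := List.attach_map_val (l := (sweedler w).filter (fun t => t.1 ≠ 1))
    (f := fun t => mon k t.1 * leftDivWord k t.2 y)
  conv_lhs => rw [leftDivWord]
  rw [← h, LinearMap.sub_apply]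
  congr 1
  generalize ((sweedler w).filter (fun t => t.1 ≠ 1)).attach = l
  induction l with
  | nil => simp
  | cons a l ih => simp [ih]

/-- Left division `u \ y` in the Hopf algebra `k{X}`. -/
def leftDiv {k X : Type*} [Field k] : FreeAlg k X →ₗ[k] FreeAlg k X →ₗ[k] FreeAlg k X :=
  Finsupp.linearCombination k (fun w => leftDivWord k w) ∘ₗ
    (MonoidAlgebra.coeffLinearEquiv k).toLinearMap

@[simp] theorem leftDiv_mon {k X : Type*} [Field k] (w : Word X) :
    leftDiv (mon k w) = leftDivWord k w := by
  simp [leftDiv, mon]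

theorem mul_eq_one_iff_word {X : Type*} (a b : Word X) : a * b = 1 ↔ a = 1 ∧ b = 1 := by
  constructor
  · intro h
    have h := congrArg degree h
    rw [degree_mul, degree_one] at h
    exact ⟨degree_eq_zero (by omega), degree_eq_zero (by omega)⟩
  · rintro ⟨rfl, rfl⟩
    simp

open Classical in
theorem filter_sweedler {X : Type*} (w : Word X) :
    (sweedler w).filter (fun t => t.1 = 1) = [(1, w)] := by
  cases w using WithOne.recOneCoe with
  | one => simp
  | coe w =>
    induction w using FreeMagma.rec with
    | of i =>
      change (sweedler (var i)).filter _ = [(1, var i)]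
      rw [sweedler_var]
      simp [var]
    | mul u v hu hv =>
      change (sweedler ((FreeMagma.mul u v : FreeMagma X) : Word X)).filter _ =
        [(1, ((FreeMagma.mul u v : FreeMagma X) : Word X))]
      rw [sweedler_coe_mul, List.filter_map]
      have : (fun t : Word X × Word X => decide (t.1 = 1)) ∘
          (fun t : (Word X × Word X) × (Word X × Word X) => (t.1.1 * t.2.1, t.1.2 * t.2.2)) =
          fun t => decide (t.1.1 = 1) && decide (t.2.1 = 1) := by
        funext t
        simp [mul_eq_one_iff_word]
      rw [this]
      have key : ∀ l l' : List (Word X × Word X),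
          (l ×ˢ l').filter (fun t => decide (t.1.1 = 1) && decide (t.2.1 = 1)) =
          l.filter (fun t => t.1 = 1) ×ˢ l'.filter (fun t => t.1 = 1) := by
        intro l l'
        induction l with
        | nil => simp
        | cons a l ih =>
          rw [List.product_cons, List.filter_append, ih, List.filter_map]
          by_cases ha : a.1 = 1
          · simp [ha, Function.comp_def, List.product_cons]
          · simp [ha, Function.comp_def]
      rw [key, hu, hv]
      rfl

/-- The defining identity of the left division: `∑ u₍₁₎ (u₍₂₎ \ y) = ε(u) y`. -/
theorem leftDiv_spec {k X : Type*} [Field k] (u y : FreeAlg k X) :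
    TensorProduct.lift ((LinearMap.mul k (FreeAlg k X)).compl₂ (leftDiv.flip y)) (comul k X u) =
      counit k X u • y := by
  classical
  induction u using FreeAlg.induction with
  | zero => simp
  | add a b ha hb => simp [add_smul, ha, hb]
  | smul_mon c w =>
    rw [map_smul, map_smul, map_smul, smul_assoc, comul_mon, map_list_sum, List.map_map]
    congr 1
    have h := leftDivWord_eq k w y
    rw [eq_sub_iff_add_eq] at h
    rw [← h]
    simp only [Function.comp_def, TensorProduct.lift.tmul, LinearMap.compl₂_apply,
      LinearMap.mul_apply', LinearMap.flip_apply, leftDiv_mon]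
    have h1 := List.sum_map_filter_add_sum_map_filter_not (fun t : Word X × Word X => t.1 = 1)
      (fun t => mon k t.1 * leftDivWord k t.2 y) (sweedler w)
    rw [filter_sweedler] at h1
    simp at h1 ⊢
    rw [← h1]
    have : mon k (1 : Word X) = 1 := rfl
    simp [this]

/-! ### The Shestakov–Umirbaev operations -/

/-- The variables `x₁, …, xₘ`, `y₁, …, yₙ`, `z`. -/
abbrev PVar (m n : ℕ) := Fin m ⊕ Fin n ⊕ Unit

/-- The non-associative polynomial `p(x₁,…,xₘ; y₁,…,yₙ; z) =
∑ (x₍₁₎ y₍₁₎) \ (x₍₂₎, y₍₂₎, z)`, where `x = ((x₁x₂)⋯)xₘ`, `y = ((y₁y₂)⋯)yₙ` and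
`(a, b, c) = (ab)c - a(bc)` is the associator. -/
def pPoly (k : Type*) [Field k] (m n : ℕ) : FreeAlg k (PVar m n) :=
  let x : Word (PVar m n) := leftNormed fun i => var (Sum.inl i)
  let y : Word (PVar m n) := leftNormed fun j => var (Sum.inr (Sum.inl j))
  let z : FreeAlg k (PVar m n) := mon k (var (Sum.inr (Sum.inr ())))
  ((sweedler x ×ˢ sweedler y).map fun t =>
    leftDiv (mon k t.1.1 * mon k t.2.1)
      ((mon k t.1.2 * mon k t.2.2) * z - mon k t.1.2 * (mon k t.2.2 * z))).sum

section Operations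

variable (k : Type*) [Field k] {A : Type*} [NonAssocRing A] [Module k A]

/-- The multilinear operation `p(x₁,…,xₘ; y₁,…,yₙ; z)` on a unital non-associative algebra. -/
def pOp {m n : ℕ} (x : Fin m → A) (y : Fin n → A) (z : A) : A :=
  eval (Sum.elim x (Sum.elim y fun _ => z)) (pPoly k m n)

/-- The operation `⟨x₁,…,xₘ; y, z⟩ = -p(x₁,…,xₘ; y; z) + p(x₁,…,xₘ; z; y)` for `m ≥ 1`,
and `⟨y, z⟩ = -[y, z]` for `m = 0`. -/
def suBracket {m : ℕ} (x : Fin m → A) (y z : A) : A :=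
  if m = 0 then -(y * z - z * y) else -pOp k x ![y] z + pOp k x ![z] y

/-- The operation `Φ(x₁,…,xₘ; y₁,…,yₙ; yₙ₊₁)` (for `m, n ≥ 1`): the symmetrization of
`p(x₁,…,xₘ; y₁,…,yₙ; yₙ₊₁)` in the `x`'s and in the `y`'s. -/
def suPhi {m n : ℕ} (x : Fin m → A) (y : Fin (n + 1) → A) : A :=
  ((m.factorial * (n + 1).factorial : ℕ) : k)⁻¹ •
    ∑ σ : Equiv.Perm (Fin m), ∑ τ : Equiv.Perm (Fin (n + 1)),
      pOp k (fun i => x (σ i)) (fun j : Fin n => y (τ j.castSucc)) (y (τ (Fin.last n)))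

end Operations

/-! ### Non-associative formal power series -/

/-- Formal power series `k{{X}}` in non-associative variables: a series is the family of its
coefficients. -/
def PowSeries (k X : Type*) := Word X → k

/-- The coefficient of a series at a monomial. -/
def coeff {k X : Type*} (w : Word X) (f : PowSeries k X) : k := f w

/-- All factorizations `w = u v` of a non-empty monomial. -/
def factorsAux {X : Type*} : FreeMagma X → List (Word X × Word X)
  | FreeMagma.of i => [(1, var i), (var i, 1)]
  | FreeMagma.mul u v =>
      [(1, ((FreeMagma.mul u v : FreeMagma X) : Word X)),
        (((FreeMagma.mul u v : FreeMagma X) : Word X), 1), ((u : Word X), (v : Word X))]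

/-- All pairs `(u, v)` of monomials with `u v = w`. -/
def factors {X : Type*} (w : Word X) : List (Word X × Word X) :=
  WithOne.recOneCoe (motive := fun _ => List (Word X × Word X)) [(1, 1)] factorsAux w

theorem factors_one {X : Type*} : factors (1 : Word X) = [(1, 1)] := rfl

theorem factors_var {X : Type*} (i : X) : factors (var i) = [(1, var i), (var i, 1)] := rfl

theorem factors_coe_mul {X : Type*} (u v : FreeMagma X) :
    factors ((FreeMagma.mul u v : FreeMagma X) : Word X) =
      [(1, ((FreeMagma.mul u v : FreeMagma X) : Word X)),
        (((FreeMagma.mul u v : FreeMagma X) : Word X), 1), ((u : Word X), (v : Word X))] := rfl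

theorem mem_factors {X : Type*} {w : Word X} {t : Word X × Word X} :
    t ∈ factors w ↔ t.1 * t.2 = w := by
  obtain ⟨a, b⟩ := t
  cases w using WithOne.recOneCoe with
  | one => simp [factors_one, mul_eq_one_iff_word]
  | coe w =>
    cases w with
    | of i =>
      change _ ∈ factors (var i) ↔ _ = var i
      rw [factors_var]
      cases a using WithOne.recOneCoe with
      | one => simp [var]
      | coe a =>
        cases b using WithOne.recOneCoe with
        | one => simp [var]
        | coe b =>
          rw [var, ← WithOne.coe_mul, WithOne.coe_inj]
          simp
    | mul u v =>
      rw [factors_coe_mul]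
      cases a using WithOne.recOneCoe with
      | one => simp [-FreeMagma.mul_eq]
      | coe a =>
        cases b using WithOne.recOneCoe with
        | one => simp [-FreeMagma.mul_eq]
        | coe b =>
          rw [← WithOne.coe_mul, WithOne.coe_inj]
          simp [-FreeMagma.mul_eq]
          constructor
          · rintro ⟨rfl, rfl⟩
            rfl
          · intro h
            cases h
            exact ⟨rfl, rfl⟩

theorem nodup_factors {X : Type*} (w : Word X) : (factors w).Nodup := by
  cases w using WithOne.recOneCoe with
  | one => simp [factors_one]
  | coe w =>
    cases w with
    | of i =>
      change (factors (var i)).Nodup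
      rw [factors_var]
      simp [var]
    | mul u v =>
      rw [factors_coe_mul]
      simp [-FreeMagma.mul_eq]

namespace PowSeries

@[ext] theorem ext {k X : Type*} {f g : PowSeries k X} (h : ∀ w, coeff w f = coeff w g) :
    f = g := funext h

variable {k X : Type*} [Field k]

instance : AddCommGroup (PowSeries k X) := inferInstanceAs (AddCommGroup (Word X → k))

instance : Module k (PowSeries k X) := inferInstanceAs (Module k (Word X → k))

open Classical in
/-- A monomial, as a series. -/
def monomial (w : Word X) : PowSeries k X := fun v => if v = w then 1 else 0

/-- A variable, as a series. -/
def gen (i : X) : PowSeries k X := monomial (var i)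

instance : One (PowSeries k X) := ⟨monomial 1⟩

instance : Mul (PowSeries k X) :=
  ⟨fun f g w => ((factors w).map fun t => coeff t.1 f * coeff t.2 g).sum⟩

@[simp] theorem coeff_zero (w : Word X) : coeff w (0 : PowSeries k X) = 0 := rfl

@[simp] theorem coeff_add (w : Word X) (f g : PowSeries k X) :
    coeff w (f + g) = coeff w f + coeff w g := rfl

@[simp] theorem coeff_neg (w : Word X) (f : PowSeries k X) : coeff w (-f) = -coeff w f := rfl

@[simp] theorem coeff_sub (w : Word X) (f g : PowSeries k X) :
    coeff w (f - g) = coeff w f - coeff w g := rfl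

@[simp] theorem coeff_smul (w : Word X) (c : k) (f : PowSeries k X) :
    coeff w (c • f) = c * coeff w f := rfl

open Classical in
theorem coeff_monomial (v w : Word X) :
    coeff v (monomial w : PowSeries k X) = if v = w then 1 else 0 := rfl

@[simp] theorem coeff_one_one : coeff 1 (1 : PowSeries k X) = 1 := by
  change coeff 1 (monomial 1 : PowSeries k X) = 1
  simp [coeff_monomial]

theorem coeff_one_of_ne {w : Word X} (h : w ≠ 1) : coeff w (1 : PowSeries k X) = 0 := by
  change coeff w (monomial 1 : PowSeries k X) = 0
  simp [coeff_monomial, h]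

theorem coeff_mul (w : Word X) (f g : PowSeries k X) :
    coeff w (f * g) = ((factors w).map fun t => coeff t.1 f * coeff t.2 g).sum := rfl

theorem coeff_mul_one (f g : PowSeries k X) : coeff 1 (f * g) = coeff 1 f * coeff 1 g := by
  simp [coeff_mul, factors_one]

instance : NonAssocRing (PowSeries k X) :=
  { (inferInstance : AddCommGroup (PowSeries k X)),
    (inferInstance : One (PowSeries k X)),
    (inferInstance : Mul (PowSeries k X)) with
    left_distrib := fun a b c => by
      ext w
      simp [coeff_mul, mul_add, List.sum_map_add]
    right_distrib := fun a b c => by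
      ext w
      simp [coeff_mul, add_mul, List.sum_map_add]
    zero_mul := fun a => by
      ext w
      simp [coeff_mul]
    mul_zero := fun a => by
      ext w
      simp [coeff_mul]
    one_mul := fun a => by
      ext w
      cases w using WithOne.recOneCoe with
      | one => simp [coeff_mul_one]
      | coe w =>
        cases w with
        | of i =>
          change coeff (var i) (1 * a) = coeff (var i) a
          rw [coeff_mul, factors_var]
          simp [coeff_one_of_ne, var]
        | mul u v =>
          rw [coeff_mul, factors_coe_mul]
          simp [coeff_one_of_ne, -FreeMagma.mul_eq]
    mul_one := fun a => by
      ext w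
      cases w using WithOne.recOneCoe with
      | one => simp [coeff_mul_one]
      | coe w =>
        cases w with
        | of i =>
          change coeff (var i) (a * 1) = coeff (var i) a
          rw [coeff_mul, factors_var]
          simp [coeff_one_of_ne, var]
        | mul u v =>
          rw [coeff_mul, factors_coe_mul]
          simp [coeff_one_of_ne, -FreeMagma.mul_eq] }

instance : IsScalarTower k (PowSeries k X) (PowSeries k X) :=
  ⟨fun c f g => by
    ext w
    simp [coeff_mul, mul_assoc, List.sum_map_mul_left]⟩

instance : SMulCommClass k (PowSeries k X) (PowSeries k X) :=
  ⟨fun c f g => by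
    ext w
    simp [coeff_mul, mul_left_comm, List.sum_map_mul_left]⟩

/-! ### Exponential and logarithm -/

/-- The left-normed power `fⁿ = (((f f) ⋯) f) f`. -/
def lpow (f : PowSeries k X) : ℕ → PowSeries k X
  | 0 => 1
  | n + 1 => lpow f n * f

/-- The exponential `exp_l(f) = ∑ₙ fⁿ / n!`, with left-normed powers, of a series `f` without
constant term: the terms with `n > deg w` do not contribute to the coefficient of `w`. -/
def expL (f : PowSeries k X) : PowSeries k X := fun w =>
  ∑ n ∈ Finset.range (degree w + 1), ((n.factorial : k))⁻¹ * coeff w (lpow f n)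

/-- The series without constant term. -/
def augIdeal (k X : Type*) [Field k] : Set (PowSeries k X) := {f | coeff 1 f = 0}

/-- The series with constant term `1`. -/
def oneAddAug (k X : Type*) [Field k] : Set (PowSeries k X) := {f | coeff 1 f = 1}

/-- The logarithm `log_l`: the inverse of the bijection `exp_l` from the series without constant
term onto the series with constant term `1`. -/
def logL (g : PowSeries k X) : PowSeries k X := Function.invFunOn expL (augIdeal k X) g

theorem coeff_expL (w : Word X) (f : PowSeries k X) :
    coeff w (expL f) =
      ∑ n ∈ Finset.range (degree w + 1), ((n.factorial : k))⁻¹ * coeff w (lpow f n) := rfl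

theorem coeff_lpow_eq_zero {f : PowSeries k X} (hf : f ∈ augIdeal k X) {n : ℕ} {w : Word X}
    (h : degree w < n) : coeff w (lpow f n) = 0 := by
  induction n generalizing w with
  | zero => omega
  | succ n ih =>
    rw [lpow, coeff_mul]
    apply List.sum_eq_zero
    intro c hc
    obtain ⟨t, ht, rfl⟩ := List.mem_map.1 hc
    have h1 := congrArg degree (mem_factors.1 ht)
    rw [degree_mul] at h1
    by_cases h2 : t.2 = 1
    · have : coeff t.2 f = 0 := by rw [h2]; exact hf
      simp [this]
    · have := degree_pos h2
      rw [ih (by omega), zero_mul]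

/-- Equality of the coefficients in degrees less than `d`. -/
def Agree (d : ℕ) (f g : PowSeries k X) : Prop := ∀ w, degree w < d → coeff w f = coeff w g

theorem Agree.mul {d : ℕ} {f g f' g' : PowSeries k X} (h : Agree d f g) (h' : Agree d f' g') :
    Agree d (f * f') (g * g') := by
  intro w hw
  rw [coeff_mul, coeff_mul]
  congr 1
  apply List.map_congr_left
  intro t ht
  have h1 := congrArg degree (mem_factors.1 ht)
  rw [degree_mul] at h1
  rw [h _ (by omega), h' _ (by omega)]

theorem Agree.lpow {d : ℕ} {f g : PowSeries k X} (h : Agree d f g) (n : ℕ) :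
    Agree d (lpow f n) (lpow g n) := by
  induction n with
  | zero => intro w _; rfl
  | succ n ih => exact ih.mul h

theorem Agree.lpow_succ {d : ℕ} {f g : PowSeries k X} (hf : f ∈ augIdeal k X)
    (hg : g ∈ augIdeal k X) (h : Agree d f g) {n : ℕ} (hn : 2 ≤ n) :
    Agree (d + 1) (PowSeries.lpow f n) (PowSeries.lpow g n) := by
  obtain ⟨n, rfl⟩ := Nat.exists_eq_add_of_le' hn
  intro w hw
  change coeff w (PowSeries.lpow f (n + 1) * f) = coeff w (PowSeries.lpow g (n + 1) * g)
  rw [coeff_mul, coeff_mul]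
  congr 1
  apply List.map_congr_left
  intro t ht
  have h1 := congrArg degree (mem_factors.1 ht)
  rw [degree_mul] at h1
  by_cases ha : t.1 = 1
  · rw [ha, coeff_lpow_eq_zero hf (by simp), coeff_lpow_eq_zero hg (by simp)]
    simp
  by_cases hb : t.2 = 1
  · have e1 : coeff t.2 f = 0 := by rw [hb]; exact hf
    have e2 : coeff t.2 g = 0 := by rw [hb]; exact hg
    rw [e1, e2]
    simp
  have := degree_pos ha
  have := degree_pos hb
  rw [h.lpow _ _ (by omega), h _ (by omega)]

/-- The terms of `exp_l(f)` that are at least quadratic in `f` only depend, in degrees at most `d`,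
on `f` in degrees less than `d`. -/
theorem Agree.expL_sub {d : ℕ} {f g : PowSeries k X} (hf : f ∈ augIdeal k X)
    (hg : g ∈ augIdeal k X) (h : Agree d f g) :
    Agree (d + 1) (expL f - f) (expL g - g) := by
  intro w hw
  rw [coeff_sub, coeff_sub, coeff_expL, coeff_expL]
  by_cases h0 : w = 1
  · subst h0
    have e1 : coeff 1 f = 0 := hf
    have e2 : coeff 1 g = 0 := hg
    simp [PowSeries.lpow, e1, e2]
  have := degree_pos h0
  obtain ⟨m, hm⟩ := Nat.exists_eq_add_of_le' this
  rw [hm, Finset.sum_range_succ', Finset.sum_range_succ', Finset.sum_range_succ',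
    Finset.sum_range_succ']
  have : ∀ n ∈ Finset.range m, ((n + 1 + 1).factorial : k)⁻¹ * coeff w (PowSeries.lpow f (n + 1 + 1))
      = ((n + 1 + 1).factorial : k)⁻¹ * coeff w (PowSeries.lpow g (n + 1 + 1)) := fun n _ => by
    rw [h.lpow_succ hf hg (by omega) w hw]
  rw [Finset.sum_congr rfl this]
  simp [PowSeries.lpow]
  ring

theorem coeff_one_expL (f : PowSeries k X) : coeff 1 (expL f) = 1 := by
  simp [coeff_expL, lpow]

/-- Successive approximations of the logarithm of `g`. -/
def logApprox (g : PowSeries k X) : ℕ → PowSeries k X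
  | 0 => 0
  | n + 1 => g - (expL (logApprox g n) - logApprox g n)

theorem logApprox_mem {g : PowSeries k X} (hg : g ∈ oneAddAug k X) (n : ℕ) :
    logApprox g n ∈ augIdeal k X := by
  have hg : coeff 1 g = 1 := hg
  induction n with
  | zero => exact coeff_zero 1
  | succ n ih =>
    have ih : coeff 1 (logApprox g n) = 0 := ih
    change coeff 1 (g - (expL (logApprox g n) - logApprox g n)) = 0
    simp [coeff_one_expL, ih, hg]

theorem logApprox_agree {g : PowSeries k X} (hg : g ∈ oneAddAug k X) (n : ℕ) :
    Agree (n + 1) (logApprox g n) (logApprox g (n + 1)) := by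
  induction n with
  | zero =>
    intro w hw
    have hw : w = 1 := degree_eq_zero (by omega)
    have h0 : coeff 1 (logApprox g 0) = 0 := logApprox_mem hg 0
    have h1 : coeff 1 (logApprox g (0 + 1)) = 0 := logApprox_mem hg 1
    rw [hw, h0, h1]
  | succ n ih =>
    intro w hw
    have := ih.expL_sub (logApprox_mem hg n) (logApprox_mem hg (n + 1)) w hw
    change coeff w (g - (expL (logApprox g n) - logApprox g n)) =
      coeff w (g - (expL (logApprox g (n + 1)) - logApprox g (n + 1)))
    rw [coeff_sub, this, ← coeff_sub]

theorem logApprox_agree_of_le {g : PowSeries k X} (hg : g ∈ oneAddAug k X) {m n : ℕ}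
    (h : m ≤ n) : Agree (m + 1) (logApprox g m) (logApprox g n) := by
  induction n, h using Nat.le_induction with
  | base => intro w _; rfl
  | succ n hmn ih =>
    intro w hw
    rw [ih w hw, logApprox_agree hg n w (by omega)]

/-- `exp_l` is a bijection from the series without constant term onto the series with constant
term `1`. -/
theorem expL_bijOn : Set.BijOn expL (augIdeal k X) (oneAddAug k X) := by
  refine ⟨fun f _ => coeff_one_expL f, ?_, ?_⟩
  · intro f hf g hg hfg
    have key : ∀ d, Agree d f g := by
      intro d
      induction d with
      | zero => intro w hw; omega
      | succ d ih =>
        intro w hw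
        have := ih.expL_sub hf hg w hw
        rw [coeff_sub, coeff_sub, hfg] at this
        exact sub_right_injective this
    ext w
    exact key _ w (Nat.lt_succ_self _)
  · intro g hg
    let f : PowSeries k X := fun w => coeff w (logApprox g (degree w))
    have hf : f ∈ augIdeal k X := logApprox_mem hg 0
    have hfa : ∀ n, Agree (n + 1) f (logApprox g n) := fun n w hw =>
      logApprox_agree_of_le hg (by omega) w (Nat.lt_succ_self _)
    refine ⟨f, hf, ?_⟩
    ext w
    by_cases h0 : w = 1
    · rw [h0, coeff_one_expL]
      exact (hg : coeff 1 g = 1).symm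
    · obtain ⟨m, hm⟩ := Nat.exists_eq_add_of_le' (degree_pos h0)
      have h1 := (hfa m).expL_sub hf (logApprox_mem hg m) w (by omega)
      have h2 := hfa (m + 1) w (by omega)
      change _ = coeff w (g - (expL (logApprox g m) - logApprox g m)) at h2
      rw [coeff_sub] at h1 h2
      rw [← h1] at h2
      linear_combination h2

theorem logL_mem {g : PowSeries k X} (hg : g ∈ oneAddAug k X) : logL g ∈ augIdeal k X :=
  Function.invFunOn_mem (expL_bijOn.surjOn hg)

theorem expL_logL {g : PowSeries k X} (hg : g ∈ oneAddAug k X) : expL (logL g) = g :=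
  Function.invFunOn_eq (expL_bijOn.surjOn hg)

theorem logL_expL {f : PowSeries k X} (hf : f ∈ augIdeal k X) : logL (expL f) = f :=
  expL_bijOn.injOn (logL_mem (expL_bijOn.mapsTo hf)) hf (expL_logL (expL_bijOn.mapsTo hf))

end PowSeries

end NonassocBCH

end

noncomputable section

namespace NonassocBCH

/-! ### Left division and `p` in low degree. -/

section Operations

variable {k : Type*} [Field k]

/-! The formula is verified rather than derived. Since `expL f - f` in degree `d` depends only on
the part of `f` below degree `d`, a series without constant term is determined in degrees below 5 by
its exponential in those degrees (`Agree.of_expL`). It therefore suffices that the exponential of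
the right-hand side agree with `expL x * expL y` up to degree 4.

Write the right-hand side as `a + b + c + d` with `a = x + y` and `b`, `c`, `d` the parts of degree
2, 3, 4 (`bchTwo`, `bchThree`, `bchFour`). Both exponentials are expanded modulo degree 5
(`expL_add_agree_five`, `expL_mul_expL_agree_five`). Comparing components leaves one identity in
each of the degrees 2, 3, 4 (`bchTwo_add`, `bchThree_add`, `bchFour_add`). These hold in every
unital non-associative algebra in characteristic zero: once the operations are written out, both
sides are the same linear combination of non-associative monomials in `x` and `y`.

Writing them out is easy in low degree. An associator with an entry 1 vanishes, so in `p` the only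
left divisions that matter are by 1 or by a single variable `v`, and `v \ u = -vu`. Moreover, `Φ`
occurs only with all `x`-arguments equal and all `y`-arguments equal, where symmetrization does
nothing. -/

theorem leftDiv_one {X : Type*} (y : FreeAlg k X) : leftDiv 1 y = y := by
  change leftDiv (mon k 1) y = y
  rw [leftDiv_mon, leftDivWord_eq]
  simp [counit]

/-- A variable is primitive with counit 0, so the defining identity reads `v(1 \ y) + 1(v \ y) = 0`.
-/
theorem leftDivWord_var {X : Type*} (i : X) (y : FreeAlg k X) :
    leftDivWord k (var i) y = -(mon k (var i) * y) := by
  rw [leftDivWord_eq]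
  have h : (var i : Word X) ≠ 1 := by simp [var]
  have h1 : leftDivWord k (1 : Word X) y = y := by
    rw [← leftDiv_mon]
    exact leftDiv_one y
  simp [counit, sweedler_var, evalWord_var, h, h1]

theorem mon_one {X : Type*} : mon k (1 : Word X) = 1 := rfl

theorem mon_mul {X : Type*} (u v : Word X) : mon k (u * v) = mon k u * mon k v := by
  simp [mon, MonoidAlgebra.single_mul_single]

theorem sweedler_var_mul_var {X : Type*} (i j : X) :
    sweedler (var i * var j) =
      [(var i * var j, 1), (var i, var j), (var j, var i), (1, var i * var j)] := by
  change sweedler ((FreeMagma.mul (.of i) (.of j) : FreeMagma X) : Word X) = _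
  rw [sweedler_coe_mul]
  change ((sweedler (var i) ×ˢ sweedler (var j)).map _) = _
  simp [sweedler_var, List.product_cons]

theorem leftNormed_one {M : Type*} [MulOneClass M] (x : Fin 1 → M) : leftNormed x = x 0 := by
  simp [leftNormed]

theorem leftNormed_two {M : Type*} [MulOneClass M] (x : Fin 2 → M) :
    leftNormed x = x 0 * x 1 := by
  simp [leftNormed]

variable {A : Type*} [NonAssocRing A] [Module k A]

variable (k) in
-- All `m! (n+1)!` summands coincide, and characteristic zero allows the normalizing factor to
-- cancel their number.
theorem suPhi_const [CharZero k] {m n : ℕ} (x y : A) :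
    suPhi k (fun _ : Fin m => x) (fun _ : Fin (n + 1) => y) =
      pOp k (fun _ : Fin m => x) (fun _ : Fin n => y) y := by
  have h : ((m.factorial * (n + 1).factorial : ℕ) : k) ≠ 0 :=
    Nat.cast_ne_zero.2 (Nat.mul_ne_zero m.factorial_ne_zero (n + 1).factorial_ne_zero)
  simp only [suPhi, Finset.sum_const, Finset.card_univ, Fintype.card_perm, Fintype.card_fin]
  rw [smul_smul, ← Nat.cast_smul_eq_nsmul k, smul_smul, inv_mul_cancel₀ h, one_smul]

/-! ### The homogeneous components of the formula -/

variable (k) in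
/-- The component of degree `2` of the Baker–Campbell–Hausdorff formula. -/
def bchTwo (x y : A) : A := (1 / 2 : k) • ⁅x, y⁆

variable (k) in
/-- The component of degree `3` of the Baker–Campbell–Hausdorff formula. -/
def bchThree (x y : A) : A :=
  (1 / 12 : k) • ⁅x, ⁅x, y⁆⁆
    - (1 / 3 : k) • suBracket k ![x] x y
    - (1 / 12 : k) • ⁅y, ⁅x, y⁆⁆
    - (1 / 6 : k) • suBracket k ![y] x y
    - (1 / 2 : k) • suPhi k ![x] ![y, y]

variable (k) in
/-- The component of degree `4` of the Baker–Campbell–Hausdorff formula. -/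
def bchFour (x y : A) : A :=
  -((1 / 24 : k) • suBracket k ![x] x ⁅x, y⁆)
    - (1 / 12 : k) • ⁅x, suBracket k ![x] x y⁆
    - (1 / 8 : k) • suBracket k ![x, x] x y
    + (1 / 24 : k) • ⁅⁅x, ⁅x, y⁆⁆, y⁆
    - (1 / 24 : k) • ⁅x, suBracket k ![y] x y⁆
    - (1 / 4 : k) • suPhi k ![x, x] ![y, y]
    - (1 / 4 : k) • ⁅x, suPhi k ![x] ![y, y]⁆
    - (1 / 24 : k) • ⁅suBracket k ![x] x y, y⁆
    - (1 / 24 : k) • suBracket k ![x] ⁅x, y⁆ y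
    - (1 / 6 : k) • suBracket k ![x, y] x y
    + (1 / 24 : k) • suBracket k ![y, x] x y
    + (1 / 12 : k) • ⁅suPhi k ![x] ![y, y], y⁆
    + (1 / 24 : k) • suBracket k ![y] y ⁅x, y⁆
    - (1 / 24 : k) • suBracket k ![y, y] x y
    - (1 / 6 : k) • suPhi k ![x] ![y, y, y]

variable (k) in
theorem bchTwo_add [CharZero k] (x y : A) :
    bchTwo k x y + (1 / 2 : k) • ((x + y) * (x + y)) =
      (1 / 2 : k) • (x * x) + x * y + (1 / 2 : k) • (y * y) := by
  simp only [bchTwo, Ring.lie_def, mul_add, add_mul]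
  module

/-! ### The operations in terms of associators. -/

variable [IsScalarTower k A A] [SMulCommClass k A A]

variable (k) in
theorem pOp_one_one (x : Fin 1 → A) (y : Fin 1 → A) (z : A) :
    pOp k x y z = associator (x 0) (y 0) z := by
  simp [pOp, pPoly, leftNormed_one, sweedler_var, List.product_cons, mon_one, leftDiv_one,
    eval_mul, evalWord_var, associator_apply]

variable (k) in
-- The factor `y₍₁₎` must be 1 and `x₍₂₎` must not be 1, since otherwise the associator vanishes.
-- The three remaining terms of the coproduct of `x₁x₂` involve division by 1, `x₁` and `x₂` only.
theorem pOp_two_one (x : Fin 2 → A) (y : Fin 1 → A) (z : A) :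
    pOp k x y z = associator (x 0 * x 1) (y 0) z - x 0 * associator (x 1) (y 0) z
      - x 1 * associator (x 0) (y 0) z := by
  simp [pOp, pPoly, leftNormed_one, leftNormed_two, sweedler_var, sweedler_var_mul_var,
    List.product_cons, mon_one, mon_mul, leftDiv_one, leftDivWord_var,
    eval_mul, evalWord_var, associator_apply, mul_sub]
  abel

variable (k) in
theorem pOp_one_two (x : Fin 1 → A) (y : Fin 2 → A) (z : A) :
    pOp k x y z = associator (x 0) (y 0 * y 1) z - y 0 * associator (x 0) (y 1) z
      - y 1 * associator (x 0) (y 0) z := by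
  simp [pOp, pPoly, leftNormed_one, leftNormed_two, sweedler_var, sweedler_var_mul_var,
    List.product_cons, mon_one, mon_mul, leftDiv_one, leftDivWord_var,
    eval_mul, evalWord_var, associator_apply, mul_sub]
  abel

variable (k) in
theorem suBracket_one (x y z : A) :
    suBracket k ![x] y z = -associator x y z + associator x z y := by
  simp [suBracket, pOp_one_one]

variable (k) in
theorem suBracket_two (x x' y z : A) :
    suBracket k ![x, x'] y z =
      -(associator (x * x') y z - x * associator x' y z - x' * associator x y z) +
        (associator (x * x') z y - x * associator x' z y - x' * associator x z y) := by
  simp [suBracket, pOp_two_one]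

variable (k) in
theorem suPhi_one_one [CharZero k] (x y : A) :
    suPhi k ![x] ![y, y] = associator x y y := by
  have := suPhi_const k (m := 1) (n := 1) x y
  rw [pOp_one_one] at this
  -- The literal vectors are constant functions, which is the form treated by `suPhi_const`.
  convert this using 2 <;> ext i <;> fin_cases i <;> rfl

variable (k) in
theorem suPhi_two_one [CharZero k] (x y : A) :
    suPhi k ![x, x] ![y, y] =
      associator (x * x) y y - x * associator x y y - x * associator x y y := by
  have := suPhi_const k (m := 2) (n := 1) x y
  rw [pOp_two_one] at this
  convert this using 2 <;> ext i <;> fin_cases i <;> rfl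

variable (k) in
theorem suPhi_one_two [CharZero k] (x y : A) :
    suPhi k ![x] ![y, y, y] =
      associator x (y * y) y - y * associator x y y - y * associator x y y := by
  have := suPhi_const k (m := 1) (n := 2) x y
  rw [pOp_one_two] at this
  convert this using 2 <;> ext i <;> fin_cases i <;> rfl

/-! ### The identities in degrees 3 and 4. -/

variable [CharZero k]

variable (k) in
theorem bchThree_add (x y : A) :
    bchThree k x y + (1 / 2 : k) • ((x + y) * bchTwo k x y + bchTwo k x y * (x + y)) +
        (1 / 6 : k) • (((x + y) * (x + y)) * (x + y)) =
      (1 / 6 : k) • ((x * x) * x) + (1 / 2 : k) • ((x * x) * y) + (1 / 2 : k) • (x * (y * y)) +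
        (1 / 6 : k) • ((y * y) * y) := by
  simp only [bchThree, bchTwo, suBracket_one, suPhi_one_one, associator_apply, Ring.lie_def,
    mul_add, add_mul, mul_sub, sub_mul, smul_mul_assoc, mul_smul_comm]
  module

set_option maxHeartbeats 4000000 in
variable (k) in
-- The left side is the degree-4 part of the exponential of the candidate, the right side that of
-- `exp_l(x) exp_l(y)`. With every operation expanded into products, only linear algebra over
-- monomials of degree 4 remains.
theorem bchFour_add (x y : A) :
    bchFour k x y +
        (1 / 2 : k) • ((x + y) * bchThree k x y + bchTwo k x y * bchTwo k x y +
          bchThree k x y * (x + y)) +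
        (1 / 6 : k) • (((x + y) * (x + y)) * bchTwo k x y +
          ((x + y) * bchTwo k x y + bchTwo k x y * (x + y)) * (x + y)) +
        (1 / 24 : k) • ((((x + y) * (x + y)) * (x + y)) * (x + y)) =
      (1 / 24 : k) • (((x * x) * x) * x) + (1 / 6 : k) • (((x * x) * x) * y) +
        (1 / 4 : k) • ((x * x) * (y * y)) + (1 / 6 : k) • (x * ((y * y) * y)) +
        (1 / 24 : k) • (((y * y) * y) * y) := by
  simp only [bchFour, bchThree, bchTwo, suBracket_one, suBracket_two, suPhi_one_one,
    suPhi_two_one, suPhi_one_two, associator_apply, Ring.lie_def,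
    mul_add, add_mul, mul_sub, sub_mul, mul_neg, neg_mul, smul_mul_assoc, mul_smul_comm]
  module

end Operations

namespace PowSeries

variable {k X : Type*} [Field k]

/-! ### The filtration by order -/

/-- The series all of whose terms have degree at least `d`. -/
def orderGe (k X : Type*) [Field k] (d : ℕ) : Submodule k (PowSeries k X) where
  carrier := {f | ∀ w, degree w < d → coeff w f = 0}
  add_mem' hf hg w hw := by rw [coeff_add, hf w hw, hg w hw, add_zero]
  zero_mem' _ _ := rfl
  smul_mem' c f hf w hw := by rw [coeff_smul, hf w hw, mul_zero]

/-- Turns congruence modulo high degree into membership in a submodule, where error terms can be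
estimated one by one. -/
theorem agree_iff_sub_mem {d : ℕ} {f g : PowSeries k X} :
    Agree d f g ↔ f - g ∈ orderGe k X d :=
  forall₂_congr fun w _ => by rw [coeff_sub, sub_eq_zero]

theorem orderGe_anti {d e : ℕ} (h : d ≤ e) : orderGe k X e ≤ orderGe k X d :=
  fun _ hf w hw => hf w (hw.trans_le h)

/-- If `uv` has degree below `d + e`, then `u` has degree below `d` or `v` has degree below `e`. The
slack `c` lets the bound be weakened in the same step. -/
theorem mul_mem_orderGe {d e c : ℕ} {f g : PowSeries k X} (hf : f ∈ orderGe k X d)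
    (hg : g ∈ orderGe k X e) (h : c ≤ d + e) : f * g ∈ orderGe k X c := by
  intro w hw
  rw [coeff_mul]
  apply List.sum_eq_zero
  intro a ha
  obtain ⟨t, ht, rfl⟩ := List.mem_map.1 ha
  have h1 := congrArg degree (mem_factors.1 ht)
  rw [degree_mul] at h1
  by_cases h2 : degree t.1 < d
  · rw [hf _ h2, zero_mul]
  · rw [hg _ (by omega), mul_zero]

theorem lie_mem_orderGe {d e c : ℕ} {f g : PowSeries k X} (hf : f ∈ orderGe k X d)
    (hg : g ∈ orderGe k X e) (h : c ≤ d + e) : ⁅f, g⁆ ∈ orderGe k X c := by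
  rw [Ring.lie_def]
  exact sub_mem (mul_mem_orderGe hf hg h) (mul_mem_orderGe hg hf (by omega))

theorem associator_mem_orderGe {d e c n : ℕ} {f g h : PowSeries k X} (hf : f ∈ orderGe k X d)
    (hg : g ∈ orderGe k X e) (hh : h ∈ orderGe k X c) (hn : n ≤ d + e + c) :
    associator f g h ∈ orderGe k X n := by
  rw [associator_apply]
  exact sub_mem (mul_mem_orderGe (mul_mem_orderGe hf hg le_rfl) hh hn)
    (mul_mem_orderGe hf (mul_mem_orderGe hg hh le_rfl) (by omega))

theorem mem_augIdeal_iff {f : PowSeries k X} : f ∈ augIdeal k X ↔ f ∈ orderGe k X 1 :=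
  ⟨fun hf w hw => by rw [degree_eq_zero (Nat.lt_one_iff.1 hw)]; exact hf,
    fun hf => hf 1 (by simp)⟩

theorem gen_mem_orderGe (i : X) : (gen i : PowSeries k X) ∈ orderGe k X 1 := by
  rw [← mem_augIdeal_iff]
  change coeff 1 (gen i) = 0
  simp [gen, coeff_monomial, var]

theorem coeff_sum {ι : Type*} (w : Word X) (s : Finset ι) (f : ι → PowSeries k X) :
    coeff w (∑ i ∈ s, f i) = ∑ i ∈ s, coeff w (f i) :=
  map_sum (⟨⟨coeff w, coeff_zero w⟩, coeff_add w⟩ : PowSeries k X →+ k) f s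

/-! ### Truncations of the exponential -/

theorem expL_agree_sum {f : PowSeries k X} (hf : f ∈ augIdeal k X) (d : ℕ) :
    Agree d (expL f) (∑ n ∈ Finset.range d, ((n.factorial : k))⁻¹ • lpow f n) := by
  intro w hw
  rw [coeff_expL, coeff_sum]
  -- The sum defining the coefficient stops at `degree w`; the powers added here exceed it and
  -- contribute nothing, as `f` has no constant term.
  refine Finset.sum_subset (Finset.range_mono hw) fun n _ hn => ?_
  rw [coeff_lpow_eq_zero hf (by simpa using hn), mul_zero]

/-- Two series without constant term whose exponentials agree in degrees less than `d` agree in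
degrees less than `d`. -/
theorem Agree.of_expL {d : ℕ} {f g : PowSeries k X} (hf : f ∈ augIdeal k X)
    (hg : g ∈ augIdeal k X) (h : Agree d (expL f) (expL g)) : Agree d f g := by
  induction d with
  | zero => intro w hw; omega
  | succ d ih =>
    intro w hw
    have := (ih fun v hv => h v (by omega)).expL_sub hf hg w hw
    rw [coeff_sub, coeff_sub, h w hw] at this
    exact sub_right_injective this

theorem expL_agree_five {f : PowSeries k X} (hf : f ∈ augIdeal k X) :
    Agree 5 (expL f) (1 + f + (1 / 2 : k) • (f * f) + (1 / 6 : k) • ((f * f) * f) +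
      (1 / 24 : k) • (((f * f) * f) * f)) := by
  convert expL_agree_sum hf 5 using 1
  simp [Finset.sum_range_succ, lpow, Nat.factorial]

theorem Agree.symm {k X : Type*} {d : ℕ} {f g : PowSeries k X} (h : Agree d f g) : Agree d g f :=
  fun w hw => (h w hw).symm

theorem Agree.trans {k X : Type*} {d : ℕ} {f g h : PowSeries k X} (h₁ : Agree d f g) (h₂ : Agree d g h) :
    Agree d f h :=
  fun w hw => (h₁ w hw).trans (h₂ w hw)

theorem expL_mul_expL_agree_five [CharZero k] {x y : PowSeries k X} (hx : x ∈ orderGe k X 1)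
    (hy : y ∈ orderGe k X 1) :
    Agree 5 (expL x * expL y)
      (1 + (x + y) + ((1 / 2 : k) • (x * x) + x * y + (1 / 2 : k) • (y * y)) +
        ((1 / 6 : k) • ((x * x) * x) + (1 / 2 : k) • ((x * x) * y) + (1 / 2 : k) • (x * (y * y)) +
          (1 / 6 : k) • ((y * y) * y)) +
        ((1 / 24 : k) • (((x * x) * x) * x) + (1 / 6 : k) • (((x * x) * x) * y) +
          (1 / 4 : k) • ((x * x) * (y * y)) + (1 / 6 : k) • (x * ((y * y) * y)) +
          (1 / 24 : k) • (((y * y) * y) * y))) := by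
  refine ((expL_agree_five (mem_augIdeal_iff.2 hx)).mul
    (expL_agree_five (mem_augIdeal_iff.2 hy))).trans ?_
  have hx2 : x * x ∈ orderGe k X 2 := mul_mem_orderGe hx hx le_rfl
  have hy2 : y * y ∈ orderGe k X 2 := mul_mem_orderGe hy hy le_rfl
  have hx3 : x * x * x ∈ orderGe k X 3 := mul_mem_orderGe hx2 hx le_rfl
  have hy3 : y * y * y ∈ orderGe k X 3 := mul_mem_orderGe hy2 hy le_rfl
  have hx4 : x * x * x * x ∈ orderGe k X 4 := mul_mem_orderGe hx3 hx le_rfl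
  have hy4 : y * y * y * y ∈ orderGe k X 4 := mul_mem_orderGe hy3 hy le_rfl
  -- Powers become atoms, longest first because shorter ones occur inside them; only bilinearity and
  -- the orders are needed from here on.
  generalize x * x * x * x = x4 at *
  generalize y * y * y * y = y4 at *
  generalize x * x * x = x3 at *
  generalize y * y * y = y3 at *
  generalize x * x = x2 at *
  generalize y * y = y2 at *
  rw [agree_iff_sub_mem]
  -- The error consists of the products of the `i`-th power of `x` and the `j`-th power of `y` with
  -- `i, j ≤ 4` and `i + j ≥ 5`, weighted by `1 / (i! j!)`.
  have key : (1 / 24 : k) • (x * y4) + (1 / 12 : k) • (x2 * y3) + (1 / 48 : k) • (x2 * y4)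
      + (1 / 12 : k) • (x3 * y2) + (1 / 36 : k) • (x3 * y3) + (1 / 144 : k) • (x3 * y4)
      + (1 / 24 : k) • (x4 * y) + (1 / 48 : k) • (x4 * y2) + (1 / 144 : k) • (x4 * y3)
      + (1 / 576 : k) • (x4 * y4) ∈ orderGe k X 5 := by
    refine add_mem (add_mem (add_mem (add_mem (add_mem (add_mem (add_mem (add_mem (add_mem
      ?_ ?_) ?_) ?_) ?_) ?_) ?_) ?_) ?_) ?_ <;> refine Submodule.smul_mem _ _ ?_
    exacts [mul_mem_orderGe hx hy4 (by norm_num), mul_mem_orderGe hx2 hy3 (by norm_num),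
      mul_mem_orderGe hx2 hy4 (by norm_num), mul_mem_orderGe hx3 hy2 (by norm_num),
      mul_mem_orderGe hx3 hy3 (by norm_num), mul_mem_orderGe hx3 hy4 (by norm_num),
      mul_mem_orderGe hx4 hy (by norm_num), mul_mem_orderGe hx4 hy2 (by norm_num),
      mul_mem_orderGe hx4 hy3 (by norm_num), mul_mem_orderGe hx4 hy4 (by norm_num)]
  convert key using 1
  simp only [mul_add, add_mul, mul_one, one_mul, smul_mul_assoc, mul_smul_comm]
  module

/-- Expansion of the exponential of `a + b + c + d` into its homogeneous components, where
`a`, `b`, `c`, `d` have orders at least `1`, `2`, `3`, `4`. -/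
theorem expL_add_agree_five {a b c d : PowSeries k X} (ha : a ∈ orderGe k X 1)
    (hb : b ∈ orderGe k X 2) (hc : c ∈ orderGe k X 3) (hd : d ∈ orderGe k X 4) :
    Agree 5 (expL (a + b + c + d))
      (1 + a + (b + (1 / 2 : k) • (a * a)) +
        (c + (1 / 2 : k) • (a * b + b * a) + (1 / 6 : k) • ((a * a) * a)) +
        (d + (1 / 2 : k) • (a * c + b * b + c * a) +
          (1 / 6 : k) • ((a * a) * b + (a * b + b * a) * a) +
          (1 / 24 : k) • (((a * a) * a) * a))) := by
  have hcd : c + d ∈ orderGe k X 3 := add_mem hc (orderGe_anti (by norm_num) hd)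
  have hbcd : b + (c + d) ∈ orderGe k X 2 := add_mem hb (orderGe_anti (by norm_num) hcd)
  have hf : a + (b + (c + d)) ∈ orderGe k X 1 := add_mem ha (orderGe_anti (by norm_num) hbcd)
  -- `q₂`, `q₃`, `q₄` are the parts of `f * f` of nominal degree 2, 3, 4. The remainders of the
  -- square, cube and fourth power are `q₅`, `r₅`, `s₅`, with tails such as `b + (c + d)` kept
  -- together so that each product needs a single order estimate.
  let q₂ := a * a
  let q₃ := a * b + b * a
  let q₄ := a * c + b * b + c * a
  let q₅ := a * d + b * (c + d) + c * (b + (c + d)) + d * (a + (b + (c + d)))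
  have h₂ : q₂ ∈ orderGe k X 2 := mul_mem_orderGe ha ha le_rfl
  have h₃ : q₃ ∈ orderGe k X 3 :=
    add_mem (mul_mem_orderGe ha hb le_rfl) (mul_mem_orderGe hb ha le_rfl)
  have h₄ : q₄ ∈ orderGe k X 4 :=
    add_mem (add_mem (mul_mem_orderGe ha hc le_rfl) (mul_mem_orderGe hb hb le_rfl))
      (mul_mem_orderGe hc ha le_rfl)
  have h₅ : q₅ ∈ orderGe k X 5 :=
    add_mem (add_mem (add_mem (mul_mem_orderGe ha hd le_rfl) (mul_mem_orderGe hb hcd le_rfl))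
      (mul_mem_orderGe hc hbcd le_rfl)) (mul_mem_orderGe hd hf le_rfl)
  let r₅ := q₂ * (c + d) + q₃ * (b + (c + d)) + (q₄ + q₅) * (a + (b + (c + d)))
  have h₅' : r₅ ∈ orderGe k X 5 :=
    add_mem (add_mem (mul_mem_orderGe h₂ hcd le_rfl) (mul_mem_orderGe h₃ hbcd le_rfl))
      (mul_mem_orderGe (add_mem h₄ (orderGe_anti (by norm_num) h₅)) hf le_rfl)
  let s₅ := q₂ * a * (b + (c + d)) + (q₂ * b + q₃ * a + r₅) * (a + (b + (c + d)))
  have h₅'' : s₅ ∈ orderGe k X 5 :=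
    add_mem (mul_mem_orderGe (mul_mem_orderGe h₂ ha le_rfl) hbcd le_rfl)
      (mul_mem_orderGe (add_mem (add_mem (mul_mem_orderGe h₂ hb le_rfl)
        (mul_mem_orderGe h₃ ha le_rfl)) (orderGe_anti (by norm_num) h₅')) hf le_rfl)
  set f := a + (b + (c + d)) with hfdef
  have e₂ : f * f = q₂ + q₃ + q₄ + q₅ := by
    simp only [hfdef, q₂, q₃, q₄, q₅, mul_add, add_mul]
    abel
  have e₃ : f * f * f = q₂ * a + (q₂ * b + q₃ * a) + r₅ := by
    rw [e₂]
    simp only [hfdef, r₅, mul_add, add_mul]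
    abel
  have e₄ : f * f * f * f = q₂ * a * a + s₅ := by
    rw [e₃]
    simp only [hfdef, s₅, mul_add, add_mul]
    abel
  have hsum : a + b + c + d = f := by
    rw [hfdef]
    abel
  rw [hsum]
  refine (expL_agree_five (mem_augIdeal_iff.2 hf)).trans ?_
  rw [e₄, e₃, e₂, agree_iff_sub_mem]
  have key := add_mem (add_mem (Submodule.smul_mem _ (1 / 2 : k) h₅)
    (Submodule.smul_mem _ (1 / 6 : k) h₅')) (Submodule.smul_mem _ (1 / 24 : k) h₅'')
  convert key using 1
  rw [hfdef]
  module

/-! ### Orders of the homogeneous components of the formula -/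

theorem suBracket_one_mem {d e c n : ℕ} {f g h : PowSeries k X} (hf : f ∈ orderGe k X d)
    (hg : g ∈ orderGe k X e) (hh : h ∈ orderGe k X c) (hn : n ≤ d + e + c) :
    suBracket k ![f] g h ∈ orderGe k X n := by
  rw [suBracket_one]
  exact add_mem (neg_mem (associator_mem_orderGe hf hg hh hn))
    (associator_mem_orderGe hf hh hg (by omega))

theorem suBracket_two_mem {f f' g h : PowSeries k X} (hf : f ∈ orderGe k X 1)
    (hf' : f' ∈ orderGe k X 1) (hg : g ∈ orderGe k X 1) (hh : h ∈ orderGe k X 1) :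
    suBracket k ![f, f'] g h ∈ orderGe k X 4 := by
  -- Stated for arbitrary `u`, `v` because the bracket uses it with both orders of the last two
  -- arguments.
  have key {u v : PowSeries k X} (hu : u ∈ orderGe k X 1) (hv : v ∈ orderGe k X 1) :
      associator (f * f') u v - f * associator f' u v - f' * associator f u v ∈ orderGe k X 4 :=
    sub_mem (sub_mem (associator_mem_orderGe (mul_mem_orderGe hf hf' le_rfl) hu hv le_rfl)
      (mul_mem_orderGe hf (associator_mem_orderGe hf' hu hv le_rfl) le_rfl))
      (mul_mem_orderGe hf' (associator_mem_orderGe hf hu hv le_rfl) le_rfl)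
  rw [suBracket_two]
  exact add_mem (neg_mem (key hg hh)) (key hh hg)

variable {x y : PowSeries k X}

theorem bchTwo_mem (hx : x ∈ orderGe k X 1) (hy : y ∈ orderGe k X 1) :
    bchTwo k x y ∈ orderGe k X 2 :=
  Submodule.smul_mem _ _ (lie_mem_orderGe hx hy le_rfl)

variable [CharZero k]

theorem suPhi_one_one_mem (hx : x ∈ orderGe k X 1) (hy : y ∈ orderGe k X 1) :
    suPhi k ![x] ![y, y] ∈ orderGe k X 3 := by
  rw [suPhi_one_one]
  exact associator_mem_orderGe hx hy hy le_rfl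

theorem suPhi_two_one_mem (hx : x ∈ orderGe k X 1) (hy : y ∈ orderGe k X 1) :
    suPhi k ![x, x] ![y, y] ∈ orderGe k X 4 := by
  have h := mul_mem_orderGe hx (associator_mem_orderGe hx hy hy le_rfl) (c := 4) le_rfl
  rw [suPhi_two_one]
  exact sub_mem (sub_mem
    (associator_mem_orderGe (mul_mem_orderGe hx hx le_rfl) hy hy le_rfl) h) h

theorem suPhi_one_two_mem (hx : x ∈ orderGe k X 1) (hy : y ∈ orderGe k X 1) :
    suPhi k ![x] ![y, y, y] ∈ orderGe k X 4 := by
  have h := mul_mem_orderGe hy (associator_mem_orderGe hx hy hy le_rfl) (c := 4) le_rfl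
  rw [suPhi_one_two]
  exact sub_mem (sub_mem
    (associator_mem_orderGe hx (mul_mem_orderGe hy hy le_rfl) hy le_rfl) h) h

theorem bchThree_mem (hx : x ∈ orderGe k X 1) (hy : y ∈ orderGe k X 1) :
    bchThree k x y ∈ orderGe k X 3 := by
  have hxy : ⁅x, y⁆ ∈ orderGe k X 2 := lie_mem_orderGe hx hy le_rfl
  refine sub_mem (sub_mem (sub_mem (sub_mem ?_ ?_) ?_) ?_) ?_ <;> refine Submodule.smul_mem _ _ ?_
  exacts [lie_mem_orderGe hx hxy le_rfl, suBracket_one_mem hx hx hy le_rfl,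
    lie_mem_orderGe hy hxy le_rfl, suBracket_one_mem hy hx hy le_rfl, suPhi_one_one_mem hx hy]

theorem bchFour_mem (hx : x ∈ orderGe k X 1) (hy : y ∈ orderGe k X 1) :
    bchFour k x y ∈ orderGe k X 4 := by
  have hxy : ⁅x, y⁆ ∈ orderGe k X 2 := lie_mem_orderGe hx hy le_rfl
  have hxxy : suBracket k ![x] x y ∈ orderGe k X 3 := suBracket_one_mem hx hx hy le_rfl
  have hyxy : suBracket k ![y] x y ∈ orderGe k X 3 := suBracket_one_mem hy hx hy le_rfl
  have hxyy := suPhi_one_one_mem hx hy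
  -- The nesting mirrors the signs in `bchFour`; each of the fifteen summands has order at least 4.
  refine sub_mem (sub_mem (add_mem (add_mem (add_mem (sub_mem (sub_mem (sub_mem (sub_mem (sub_mem
    (sub_mem (add_mem (sub_mem (sub_mem (neg_mem ?_) ?_) ?_) ?_) ?_) ?_) ?_) ?_) ?_) ?_) ?_) ?_)
    ?_) ?_) ?_ <;> refine Submodule.smul_mem _ _ ?_
  exacts [suBracket_one_mem hx hx hxy le_rfl, lie_mem_orderGe hx hxxy le_rfl,
    suBracket_two_mem hx hx hx hy,
    lie_mem_orderGe (lie_mem_orderGe hx hxy le_rfl) hy le_rfl, lie_mem_orderGe hx hyxy le_rfl,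
    suPhi_two_one_mem hx hy, lie_mem_orderGe hx hxyy le_rfl, lie_mem_orderGe hxxy hy le_rfl,
    suBracket_one_mem hx hxy hy le_rfl, suBracket_two_mem hx hy hx hy,
    suBracket_two_mem hy hx hx hy, lie_mem_orderGe hxyy hy le_rfl,
    suBracket_one_mem hy hy hxy le_rfl, suBracket_two_mem hy hy hx hy, suPhi_one_two_mem hx hy]

/-- The Baker–Campbell–Hausdorff formula for two series without constant term. -/
theorem logL_expL_mul_expL_agree_five (hx : x ∈ orderGe k X 1) (hy : y ∈ orderGe k X 1) :
    Agree 5 (logL (expL x * expL y))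
      (x + y + bchTwo k x y + bchThree k x y + bchFour k x y) := by
  have hxy : x + y ∈ orderGe k X 1 := add_mem hx hy
  have h2 := bchTwo_mem hx hy
  have h3 := bchThree_mem hx hy
  have h4 := bchFour_mem hx hy
  have hG : expL x * expL y ∈ oneAddAug k X := by
    change coeff 1 (expL x * expL y) = 1
    rw [coeff_mul_one, coeff_one_expL, coeff_one_expL, one_mul]
  have hF : x + y + bchTwo k x y + bchThree k x y + bchFour k x y ∈ augIdeal k X :=
    mem_augIdeal_iff.2 (add_mem (add_mem (add_mem hxy (orderGe_anti (by norm_num) h2))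
      (orderGe_anti (by norm_num) h3)) (orderGe_anti (by norm_num) h4))
  -- Comparing exponentials removes the logarithm.
  refine Agree.of_expL (logL_mem hG) hF ?_
  rw [expL_logL hG]
  have h := expL_add_agree_five hxy h2 h3 h4
  -- The three identities rewrite the expansion for the candidate into the one for `expL x * expL
  -- y`.
  rw [bchTwo_add, bchThree_add, bchFour_add] at h
  exact (expL_mul_expL_agree_five hx hy).trans h.symm

end PowSeries

end NonassocBCH
end

open NonassocBCH NonassocBCH.PowSeries in
/-- In degrees less than `5`, the series `log_l(exp_l(x) exp_l(y))` in `k{{x, y}}` is given by the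
displayed expression. -/
theorem theorem3p7 (k : Type*) [Field k] [CharZero k] :
    let x : PowSeries k (Fin 2) := gen 0
    let y : PowSeries k (Fin 2) := gen 1
    ∀ w : Word (Fin 2), degree w < 5 →
      coeff w (logL (expL x * expL y)) =
      coeff w
        (x + y + (1 / 2 : k) • ⁅x, y⁆
          + (1 / 12 : k) • ⁅x, ⁅x, y⁆⁆
          - (1 / 3 : k) • suBracket k ![x] x y
          - (1 / 12 : k) • ⁅y, ⁅x, y⁆⁆
          - (1 / 6 : k) • suBracket k ![y] x y
          - (1 / 2 : k) • suPhi k ![x] ![y, y]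
          - (1 / 24 : k) • suBracket k ![x] x ⁅x, y⁆
          - (1 / 12 : k) • ⁅x, suBracket k ![x] x y⁆
          - (1 / 8 : k) • suBracket k ![x, x] x y
          + (1 / 24 : k) • ⁅⁅x, ⁅x, y⁆⁆, y⁆
          - (1 / 24 : k) • ⁅x, suBracket k ![y] x y⁆
          - (1 / 4 : k) • suPhi k ![x, x] ![y, y]
          - (1 / 4 : k) • ⁅x, suPhi k ![x] ![y, y]⁆
          - (1 / 24 : k) • ⁅suBracket k ![x] x y, y⁆
          - (1 / 24 : k) • suBracket k ![x] ⁅x, y⁆ y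
          - (1 / 6 : k) • suBracket k ![x, y] x y
          + (1 / 24 : k) • suBracket k ![y, x] x y
          + (1 / 12 : k) • ⁅suPhi k ![x] ![y, y], y⁆
          + (1 / 24 : k) • suBracket k ![y] y ⁅x, y⁆
          - (1 / 24 : k) • suBracket k ![y, y] x y
          - (1 / 6 : k) • suPhi k ![x] ![y, y, y]) := by
  intro x y w hw
  rw [logL_expL_mul_expL_agree_five (gen_mem_orderGe 0) (gen_mem_orderGe 1) w hw]
  congr 1
  -- The displayed sum has the same summands as the three components, bracketed differently.
  simp only [bchTwo, bchThree, bchFour, x, y]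
  abel
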